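/- Let $d\ge 2$. For $x\in\mathbb Z^d$ write $\|x\|_1=\sum_{i=1}^d|x_i|$, and for $p\in[0,1]$ let $\pi_p$ be the law on $\{0,1\}^{\mathbb Z^d}$ of independent Bernoulli random variables of parameter $p$. Call a set $G\subset\mathbb Z^d$ connected if any two points $u,v\in G$ can be joined by a finite sequence $u=u_0,u_1,\dots,u_n=v$ of points of $G$ with $\|u_{i+1}-u_i\|_1=1$ for $0\le i<n$. For $z\in\mathbb Z^d$ let $d(z,G)=\inf_{y\in G}\|y-z\|_1$ (so $d(z,\emptyset)=\infty$). For $x\in\mathbb Z^d\setminus\{0\}$, constants $C_0,\delta>0$ and a configuration $\omega\in\{0,1\}^{\mathbb Z^d}$, a global structure around $0$ and $x$ with constants $C_0,\delta$ is a connected set $G\subset\mathbb Z^d$ such that $\omega_y=1$ for all $y\in G$, $|G|\le C_0\|x\|_1$, $d(0,G)\le(\log\|x\|_1)^{1+\delta}$ and $d(x,G)\le(\log\|x\|_1)^{1+\delta}$. Let $\mathcal G(x,C_0,\delta)$ be the event that such a global structure exists. **Proposition.** For every $d\ge2$ there exists $\alpha_d\in(0,1)$ such that for every $\delta>0$ there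 exist constants $c,C,C_0>0$ (depending only on $d$ and $\delta$) such that, for every $p\in[1-\alpha_d,1]$ and every $x\in\mathbb Z^d\setminus\{0\}$, $$\pi_p\bigl(\mathcal G(x,C_0,\delta)\bigr)>1-C\,e^{-c(\log\|x\|_1)^{1+\delta}}.$$ -/

import Mathlib

namespace SitePercolation

open MeasureTheory
open scoped ENNReal

/-- The lattice `ℤ^d`. -/
abbrev Lattice (d : ℕ) : Type := Fin d → ℤ

/-- The norm `‖x‖₁ = ∑ |x_i|` of a lattice point (a natural number). -/
def norm1 {d : ℕ} (x : Lattice d) : ℕ := ∑ i, (x i).natAbs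

/-- Percolation configurations `ω ∈ {0,1}^{ℤ^d}`; `true` is `1` (open), `false` is `0` (closed). -/
abbrev Config (d : ℕ) : Type := Lattice d → Bool

/-- The law `π_p` of independent Bernoulli variables of parameter `p` indexed by `ℤ^d`
(each site takes the value `true` with probability `p`). -/
noncomputable def bernoulliLaw (d : ℕ) (p : unitInterval) : Measure (Config d) :=
  Measure.infinitePi fun _ : Lattice d => ProbabilityTheory.bernoulliMeasure true false p

/-- `x` and `y` are connected within `A`: there is a finite sequence `s 0 = x, …, s n = y` of
points of `A` with consecutive points at `ℓ¹`-distance `1`. -/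
def ConnectedWithin {d : ℕ} (A : Set (Lattice d)) (x y : Lattice d) : Prop :=
  ∃ (n : ℕ) (s : ℕ → Lattice d), s 0 = x ∧ s n = y ∧ (∀ i ≤ n, s i ∈ A) ∧
    ∀ i < n, norm1 (s (i + 1) - s i) = 1

/-- `A` is connected: any two of its points are connected within `A`. -/
def IsLatticeConnected {d : ℕ} (A : Set (Lattice d)) : Prop :=
  ∀ x ∈ A, ∀ y ∈ A, ConnectedWithin A x y

/-- The `ℓ¹`-distance from the point `z` to the set `G` (it is `∞` when `G` is empty). -/
noncomputable def distToSet {d : ℕ} (z : Lattice d) (G : Set (Lattice d)) : ℝ≥0∞ :=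
  ⨅ y ∈ G, (norm1 (y - z) : ℝ≥0∞)

/-- `G` is a global structure around `0` and `x` with constants `C₀, δ` in the configuration
`ω`. -/
structure IsGlobalStructure {d : ℕ} (ω : Config d) (x : Lattice d) (C₀ δ : ℝ)
    (G : Set (Lattice d)) : Prop where
  isOpen : ∀ y ∈ G, ω y = true
  finite : G.Finite
  card_le : (G.ncard : ℝ) ≤ C₀ * (norm1 x : ℝ)
  connected : IsLatticeConnected G
  dist_zero_le : distToSet 0 G ≤ ENNReal.ofReal (Real.log (norm1 x : ℝ) ^ (1 + δ))
  dist_le : distToSet x G ≤ ENNReal.ofReal (Real.log (norm1 x : ℝ) ^ (1 + δ))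

/-- The event that there is a global structure around `0` and `x` with constants `C₀, δ`. -/
def globalEvent {d : ℕ} (x : Lattice d) (C₀ δ : ℝ) : Set (Config d) :=
  {ω | ∃ G : Set (Lattice d), IsGlobalStructure ω x C₀ δ G}

/-- The event above is measurable, so its probability is meaningful. -/
theorem measurableSet_globalEvent {d : ℕ} (x : Lattice d) (C₀ δ : ℝ) :
    MeasurableSet (globalEvent x C₀ δ) := by
  have h : globalEvent x C₀ δ = ⋃ G : Finset (Lattice d),
      {ω : Config d | IsGlobalStructure ω x C₀ δ (G : Set (Lattice d))} := by
    ext ω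
    simp only [globalEvent, Set.mem_ofPred_eq, Set.mem_iUnion]
    constructor
    · rintro ⟨G, hG⟩
      refine ⟨hG.finite.toFinset, ?_⟩
      rwa [Set.Finite.coe_toFinset]
    · rintro ⟨G, hG⟩
      exact ⟨_, hG⟩
  rw [h]
  refine MeasurableSet.iUnion fun G => ?_
  by_cases hG : ∃ ω : Config d, IsGlobalStructure ω x C₀ δ (G : Set (Lattice d))
  · obtain ⟨ω₀, h₀⟩ := hG
    have h' : {ω : Config d | IsGlobalStructure ω x C₀ δ (G : Set (Lattice d))} =
        ⋂ y ∈ G, (fun ω : Config d => ω y) ⁻¹' {true} := by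
      ext ω
      simp only [Set.mem_ofPred_eq, Set.mem_iInter, Set.mem_preimage, Set.mem_singleton_iff]
      exact ⟨fun h y hy => h.isOpen y hy, fun h => ⟨fun y hy => h y hy, h₀.finite, h₀.card_le,
        h₀.connected, h₀.dist_zero_le, h₀.dist_le⟩⟩
    rw [h']
    exact Finset.measurableSet_biInter G fun y _ =>
      measurable_pi_apply y (measurableSet_singleton true)
  · have h' : {ω : Config d | IsGlobalStructure ω x C₀ δ (G : Set (Lattice d))} = ∅ := by
      ext ω
      simp only [Set.mem_ofPred_eq, Set.mem_empty_iff_false, iff_false]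
      exact fun h => hG ⟨ω, h⟩
    rw [h']
    exact MeasurableSet.empty

end SitePercolation

namespace SitePercolation

/-! Fix a geodesic from `0` to `x` of length `n = norm1 x` and repeatedly attach closed sites at
sup-distance at most `2` from the current set. Each attachment lengthens a covering walk by two
steps, so the event that `n` sites can be attached is covered by `(5 ^ d) ^ (3 * n)` step lists,
each of probability at most `α ^ n`; for small `α` this is at most `exp (-n)`
(`growthEvent_real_le`). Otherwise the growth stops, and the closed sites of the final set form a
set `W` of size `O(n)` such that every closed site near `W` is in `W` (`exists_terminal_trace`).

Let `O` be the outer component of the complement of `W`. The points of `O` that lie on the geodesic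
or near `W` are open, and there are `O(n)` of them. Each end of the geodesic is extended along an
axis until it enters `O`. The resulting walk can be rerouted through those open points
(`connectedWithin_detour`), because the lattice has no first cohomology mod 2: a suitable cochain
counting crossings of the boundary of `O` has a potential (`exists_potential`). The same principle
shows that the two ends of an excursion out of `O` belong to one cluster of near points of `W`
(`reflTransGen_near_of_excursion`).

Hence the extensions have length at most `4 * m + 1` unless `m` closed sites can be attached to some
point of a box of side `O(n)`, which has probability at most `O(n ^ d) * exp (-m)`. With `m` about
`(log n) ^ (1 + δ) / 4` the factor `n ^ d` is absorbed since `δ > 0`. -/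

/-! ### Lattice geometry, connectedness and geodesics. -/

/-- The lattice basis vector in direction `i`. -/
abbrev unitVec {d : ℕ} (i : Fin d) : Lattice d := Pi.single i 1

theorem norm1_neg {d : ℕ} (x : Lattice d) : norm1 (-x) = norm1 x := by simp [norm1]

theorem norm1_sub_comm {d : ℕ} (x y : Lattice d) : norm1 (x - y) = norm1 (y - x) := by
  rw [← norm1_neg, neg_sub]

theorem norm1_single {d : ℕ} (i : Fin d) (k : ℤ) :
    norm1 (Pi.single i k : Lattice d) = k.natAbs := by
  rw [norm1, Finset.sum_eq_single i] <;> simp +contextual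

theorem natAbs_le_norm1 {d : ℕ} (x : Lattice d) (i : Fin d) : (x i).natAbs ≤ norm1 x :=
  Finset.single_le_sum (f := fun i => (x i).natAbs) (fun _ _ => Nat.zero_le _) (Finset.mem_univ i)

theorem norm1_eq_zero {d : ℕ} {x : Lattice d} : norm1 x = 0 ↔ x = 0 := by
  simp [norm1, funext_iff]

theorem eq_unitVec_of_norm1_eq_one {d : ℕ} {v : Lattice d} (h : norm1 v = 1) :
    ∃ i, v = unitVec i ∨ v = -unitVec i := by
  have hv : v ≠ 0 := fun h0 => by rw [norm1_eq_zero.2 h0] at h; omega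
  obtain ⟨i, hi⟩ : ∃ i, v i ≠ 0 := by
    by_contra! hc
    exact hv (funext hc)
  have hsum : (v i).natAbs + ∑ j ∈ Finset.univ.erase i, (v j).natAbs = 1 := by
    rw [Finset.add_sum_erase _ (fun j => (v j).natAbs) (Finset.mem_univ i)]; exact h
  have h0 : ∑ j ∈ Finset.univ.erase i, (v j).natAbs = 0 := by
    have := Int.natAbs_pos.2 hi
    omega
  rw [Finset.sum_eq_zero_iff] at h0
  have hz : ∀ j, j ≠ i → v j = 0 := fun j hj => by simpa using h0 j (by simp [hj])
  have h1 : v i = 1 ∨ v i = -1 := by omega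
  refine ⟨i, h1.imp (fun h1 => ?_) (fun h1 => ?_)⟩ <;>
  · funext j
    by_cases hj : j = i
    · subst hj; simp [h1]
    · simp [hz j hj, hj]

section Connected

variable {d : ℕ} {A : Set (Lattice d)} {x y z : Lattice d}

theorem ConnectedWithin.refl (hx : x ∈ A) : ConnectedWithin A x x :=
  ⟨0, fun _ => x, rfl, rfl, fun _ _ => hx, fun i hi => absurd hi (Nat.not_lt_zero i)⟩

theorem ConnectedWithin.mem_right (h : ConnectedWithin A x y) : y ∈ A := by
  obtain ⟨n, s, -, rfl, h, -⟩ := h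
  exact h n le_rfl

theorem ConnectedWithin.tail (h : ConnectedWithin A x y) (hz : z ∈ A) (hyz : norm1 (z - y) = 1) :
    ConnectedWithin A x z := by
  obtain ⟨n, s, h0, hn, hA, hs⟩ := h
  refine ⟨n + 1, fun i => if i ≤ n then s i else z, by simp [h0], by simp, fun i _ => ?_,
    fun i hi => ?_⟩
  · by_cases h : i ≤ n
    · simpa [h] using hA i h
    · simpa [h] using hz
  · rcases Nat.lt_succ_iff_lt_or_eq.1 hi with h | rfl
    · simpa [h.le, Nat.succ_le_of_lt h] using hs i h
    · simpa [hn] using hyz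

/-- A property that holds at `x` and is preserved by the steps inside `A` holds at `y`. -/
theorem ConnectedWithin.induction {P : Lattice d → Prop} (h : ConnectedWithin A x y) (hx : P x)
    (hstep : ∀ u ∈ A, ∀ v ∈ A, norm1 (v - u) = 1 → P u → P v) : P y := by
  obtain ⟨n, s, rfl, rfl, hA, hs⟩ := h
  have : ∀ i ≤ n, P (s i) := by
    intro i
    induction i with
    | zero => exact fun _ => hx
    | succ i ih =>
      exact fun hi => hstep _ (hA i (by omega)) _ (hA _ hi) (hs i (by omega)) (ih (by omega))
  exact this n le_rfl

theorem ConnectedWithin.trans (h : ConnectedWithin A x y) (h' : ConnectedWithin A y z) :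
    ConnectedWithin A x z :=
  h'.induction (P := fun w => ConnectedWithin A x w) h fun _ _ _ hv huv hu => hu.tail hv huv

theorem ConnectedWithin.symm (h : ConnectedWithin A x y) : ConnectedWithin A y x := by
  have hx : x ∈ A := by
    obtain ⟨n, s, rfl, -, h, -⟩ := h
    exact h 0 (Nat.zero_le _)
  refine h.induction (P := fun w => ConnectedWithin A w x) (.refl hx) fun u hu v hv huv h => ?_
  exact ((ConnectedWithin.refl hv).tail hu (by rw [norm1_sub_comm, huv])).trans h

/-- The connected component of a point within `A` is connected. -/
theorem isLatticeConnected_component (A : Set (Lattice d)) (x : Lattice d) :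
    IsLatticeConnected {y | ConnectedWithin A x y} := by
  have key : ∀ y, ConnectedWithin A x y → ConnectedWithin {y | ConnectedWithin A x y} x y := by
    intro y hy
    have hx : x ∈ A := hy.symm.mem_right
    refine (hy.induction (P := fun w => ConnectedWithin A x w ∧
      ConnectedWithin {y | ConnectedWithin A x y} x w) ⟨.refl hx, .refl (.refl hx)⟩ ?_).2
    rintro u - v hv huv ⟨h1, h2⟩
    exact ⟨h1.tail hv huv, h2.tail (h1.tail hv huv) huv⟩
  exact fun u hu v hv => (key u hu).symm.trans (key v hv)

end Connected

/-- A geodesic from `x` to `y`; it does not move the coordinates in which `x` and `y` agree. -/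
theorem exists_geodesic {d : ℕ} (n : ℕ) : ∀ x y : Lattice d, norm1 (y - x) = n →
    ∃ s : ℕ → Lattice d, s 0 = x ∧ s n = y ∧ (∀ k < n, norm1 (s (k + 1) - s k) = 1) ∧
      ∀ k ≤ n, ∀ i, x i = y i → s k i = x i := by
  induction n with
  | zero =>
    intro x y h
    have hxy : y = x := sub_eq_zero.1 (norm1_eq_zero.1 h)
    exact ⟨fun _ => x, rfl, hxy.symm, fun k hk => absurd hk (Nat.not_lt_zero k), fun _ _ _ _ => rfl⟩
  | succ n ih =>
    intro x y h
    obtain ⟨i, hi⟩ : ∃ i, (y - x) i ≠ 0 := by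
      by_contra! hc
      rw [norm1_eq_zero.2 (funext hc)] at h
      omega
    obtain ⟨ε, hε, hlt⟩ : ∃ ε : ℤ, ε.natAbs = 1 ∧
        ((y - x) i - ε).natAbs + 1 = ((y - x) i).natAbs := by
      rcases lt_or_gt_of_ne hi with h | h
      · exact ⟨-1, rfl, by omega⟩
      · exact ⟨1, rfl, by omega⟩
    have h' : norm1 (y - (x + (Pi.single i ε : Lattice d))) = n := by
      have e1 := Finset.add_sum_erase Finset.univ (fun j => ((y - x) j).natAbs) (Finset.mem_univ i)
      have e2 := Finset.add_sum_erase Finset.univ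
        (fun j => ((y - (x + (Pi.single i ε : Lattice d))) j).natAbs) (Finset.mem_univ i)
      have e3 : ∑ j ∈ Finset.univ.erase i, ((y - (x + (Pi.single i ε : Lattice d))) j).natAbs =
          ∑ j ∈ Finset.univ.erase i, ((y - x) j).natAbs := by
        refine Finset.sum_congr rfl fun j hj => ?_
        simp [Finset.ne_of_mem_erase hj]
      have e4 : (y - (x + (Pi.single i ε : Lattice d))) i = (y - x) i - ε := by simp; ring
      simp only [norm1] at h ⊢
      rw [← e2, e3, e4]
      rw [← e1] at h
      omega
    obtain ⟨s, h0, hn, hs, hc⟩ := ih _ _ h'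
    refine ⟨fun k => if k = 0 then x else s (k - 1), by simp, by simpa using hn, fun k hk => ?_,
      fun k hk j hj => ?_⟩
    · rcases k with _ | k
      · simp [h0, norm1_single, hε]
      · simpa using hs k (by omega)
    · rcases k with _ | k
      · simp
      · have hji : j ≠ i := fun e => hi (by simp [← e, hj])
        simpa [hji, hj] using hc k (by omega) j (by simp [hji, hj])

/-! ### Vanishing of the first cohomology of the cubical lattice. -/

/-- One sum integrates to the right of the origin and the other to the left; at every `t` at least
one of them is empty. -/
theorem exists_int_primitive {A : Type*} [AddCommGroup A] (φ : ℤ → A) :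
    ∃ S : ℤ → A, ∀ t, S (t + 1) = S t + φ t := by
  refine ⟨fun t => ∑ k ∈ Finset.range t.toNat, φ k -
    ∑ k ∈ Finset.range (-t).toNat, φ (-((k : ℤ) + 1)), fun t => ?_⟩
  rcases le_or_gt 0 t with h | h
  · have h1 : (t + 1).toNat = t.toNat + 1 := by omega
    have h2 : (-(t + 1)).toNat = 0 := by omega
    have h3 : (-t).toNat = 0 := by omega
    have h4 : ((t.toNat : ℕ) : ℤ) = t := by omega
    simp only [h1, h2, h3, Finset.sum_range_succ, h4, Finset.range_zero, Finset.sum_empty, sub_zero]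
  · have h1 : (t + 1).toNat = 0 := by omega
    have h2 : (-t).toNat = (-(t + 1)).toNat + 1 := by omega
    have h3 : t.toNat = 0 := by omega
    have h4 : -((((-(t + 1)).toNat : ℕ) : ℤ) + 1) = t := by omega
    simp only [h1, h2, h3, Finset.sum_range_succ, h4, Finset.range_zero, Finset.sum_empty]
    abel

/-- A one-cochain of the cubical lattice that is closed on the unit squares is a coboundary. -/
theorem exists_potential {d : ℕ} {A : Type*} [AddCommGroup A] (a : Lattice d → Fin d → A)
    (h : ∀ x i j, a x i + a (x + unitVec i) j = a x j + a (x + unitVec j) i) :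
    ∃ f : Lattice d → A, ∀ x i, f (x + unitVec i) = f x + a x i := by
  suffices H : ∀ s : Finset (Fin d), ∃ f : Lattice d → A, ∀ x, ∀ i ∈ s,
      f (x + unitVec i) = f x + a x i by
    obtain ⟨f, hf⟩ := H Finset.univ
    exact ⟨f, fun x i => hf x i (Finset.mem_univ i)⟩
  intro s
  induction s using Finset.induction_on with
  | empty => exact ⟨0, by simp⟩
  | insert j s hj ih =>
    obtain ⟨f, hf⟩ := ih
    -- The defect of `f` in direction `j`. Closedness makes it invariant under steps in the
    -- directions of `s`, so adding its primitive along the `j`-axis repairs direction `j` without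
    -- spoiling those in `s`.
    let b : Lattice d → A := fun x => a x j - (f (x + unitVec j) - f x)
    have hb : ∀ x, ∀ i ∈ s, b (x + unitVec i) = b x := by
      intro x i hi
      have e1 := h x i j
      have e2 := hf x i hi
      have e3 := hf (x + unitVec j) i hi
      have e4 : x + unitVec i + unitVec j = x + unitVec j + unitVec i := by abel
      simp only [b, e4, e2, e3]
      rw [← sub_eq_zero] at e1 ⊢
      rw [← e1]
      abel
    choose S hS using fun φ : ℤ → A => exists_int_primitive φ
    refine ⟨fun x => f x + S (fun t => b (Function.update x j t)) (x j), fun x i hi => ?_⟩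
    rcases eq_or_ne i j with rfl | hij
    · have e1 : (fun t => b (Function.update (x + unitVec i) i t)) =
          fun t => b (Function.update x i t) := by
        funext t
        congr 1
        funext k
        by_cases hk : k = i
        · subst hk; simp
        · simp [hk]
      have e2 : (x + unitVec i : Lattice d) i = x i + 1 := by simp
      simp only [e1, e2, hS, Function.update_eq_self, b]
      abel
    · have hi' : i ∈ s := by simpa [hij] using hi
      have e1 : (fun t => b (Function.update (x + unitVec i) j t)) =
          fun t => b (Function.update x j t) := by
        funext t
        rw [← hb (Function.update x j t) i hi']
        congr 1
        funext k
        by_cases hk : k = j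
        · subst hk; simp [hij.symm]
        · simp [hk]
      have e2 : (x + unitVec i : Lattice d) j = x j := by simp [hij.symm]
      simp only [e1, e2, hf x i hi']
      abel

/-- The potential of a symmetric `ZMod 2`-valued cochain on nearest-neighbour pairs that is closed
on the unit squares. -/
theorem exists_potential_of_symm {d : ℕ} (a : Lattice d → Lattice d → ZMod 2)
    (hsymm : ∀ x y, a x y = a y x)
    (h : ∀ x (i j : Fin d), i ≠ j → a x (x + unitVec i) + a (x + unitVec i) (x + unitVec i + unitVec j)
      = a x (x + unitVec j) + a (x + unitVec j) (x + unitVec i + unitVec j)) :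
    ∃ f : Lattice d → ZMod 2, ∀ x y, norm1 (y - x) = 1 → f y = f x + a x y := by
  obtain ⟨f, hf⟩ := exists_potential (fun x (i : Fin d) => a x (x + unitVec i)) (by
    intro x i j
    rcases eq_or_ne i j with rfl | hij
    · rfl
    · have e4 : x + unitVec j + unitVec i = x + unitVec i + unitVec j := by abel
      simpa only [e4] using h x i j hij)
  refine ⟨f, fun x y hxy => ?_⟩
  obtain ⟨i, hi | hi⟩ := eq_unitVec_of_norm1_eq_one hxy
  · obtain rfl : y = x + unitVec i := by rw [← hi]; abel
    exact hf x i
  · obtain rfl : x = y + unitVec i := by rw [← neg_eq_iff_eq_neg.2 hi]; abel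
    rw [hf y i, hsymm (y + unitVec i) y, add_assoc, CharTwo.add_self_eq_zero, add_zero]

/-! ### Crossing the boundary of a connected set. -/

/-- Two lattice points whose coordinates differ by at most `2`. -/
def Near {d : ℕ} (u v : Lattice d) : Prop := ∀ k, |v k - u k| ≤ 2

theorem Near.symm {d : ℕ} {u v : Lattice d} (h : Near u v) : Near v u :=
  fun k => by rw [abs_sub_comm]; exact h k

/-- `v` is a corner of the unit cube with lowest corner `x`. -/
def InCube {d : ℕ} (x v : Lattice d) : Prop := ∀ k, x k ≤ v k ∧ v k ≤ x k + 1

theorem InCube.near {d : ℕ} {x u v : Lattice d} (hu : InCube x u) (hv : InCube x v) : Near u v :=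
  fun k => abs_le.2 ⟨by linarith [(hu k).2, (hv k).1], by linarith [(hu k).1, (hv k).2]⟩

theorem inCube_square {d : ℕ} (x : Lattice d) {i j : Fin d} (hij : i ≠ j) :
    InCube x x ∧ InCube x (x + unitVec i) ∧ InCube x (x + unitVec j) ∧
      InCube x (x + unitVec i + unitVec j) := by
  refine ⟨fun k => ?_, fun k => ?_, fun k => ?_, fun k => ?_⟩
  · simp
  · by_cases h : k = i
    · subst h; simp
    · simp [h]
  · by_cases h : k = j
    · subst h; simp
    · simp [h]
  · by_cases h : k = i
    · subst h; simp [hij]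
    · by_cases h' : k = j
      · subst h'; simp [h]
      · simp [h, h']

theorem norm1_square {d : ℕ} (x : Lattice d) (i j : Fin d) :
    norm1 (x + unitVec i - x) = 1 ∧ norm1 (x + unitVec i + unitVec j - (x + unitVec i)) = 1 ∧
      norm1 (x + unitVec j - x) = 1 ∧ norm1 (x + unitVec i + unitVec j - (x + unitVec j)) = 1 := by
  have e : x + unitVec i + unitVec j - (x + unitVec j) = unitVec i := by abel
  rw [e]
  simp [norm1_single]

/-- The coboundary of a function on vertices is closed on a square; this is the form in which
closedness is checked below. -/
theorem zmod_two_add_cancel (a b c e : ZMod 2) : a + b + (b + c) = a + e + (e + c) := by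
  revert a b c e; decide

section Boundary

variable {d : ℕ} {O W : Set (Lattice d)}

/-- The potential is constant on a connected set on which the cochain vanishes. -/
theorem potential_eq_of_connected {a : Lattice d → Lattice d → ZMod 2} {f : Lattice d → ZMod 2}
    (hf : ∀ x y, norm1 (y - x) = 1 → f y = f x + a x y) (ha : ∀ x ∈ O, ∀ y ∈ O, a x y = 0)
    {x y : Lattice d} (h : ConnectedWithin O x y) : f y = f x :=
  h.induction (P := fun w => f w = f x) rfl fun u hu v hv huv hfu => by
    rw [hf u v huv, ha u hu v hv, add_zero, hfu]

open Classical in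
/-- Let `O` be connected, with boundary edges to its complement ending in `W`. A walk between two
points of `O` can be rerouted through the points of `O` that it visits or that are near `W`. -/
theorem connectedWithin_detour (hO : IsLatticeConnected O)
    (hW : ∀ u v, u ∉ O → v ∈ O → norm1 (v - u) = 1 → u ∈ W)
    {H : Set (Lattice d)} (hHO : H ⊆ O) (hH : ∀ w ∈ O, ∀ u ∈ W, Near u w → w ∈ H)
    {t : ℕ → Lattice d} {N : ℕ} (ht : ∀ i < N, norm1 (t (i + 1) - t i) = 1)
    (htH : ∀ i ≤ N, t i ∈ O → t i ∈ H) (h0 : t 0 ∈ O) (hN : t N ∈ O) :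
    ConnectedWithin H (t 0) (t N) := by
  let P : Set (Lattice d) := {v | ConnectedWithin H (t 0) v}
  have hPH : P ⊆ H := fun v hv => ConnectedWithin.mem_right hv
  have hP : ∀ u ∈ H, ∀ v ∈ H, norm1 (v - u) = 1 → (u ∈ P ↔ v ∈ P) := fun u hu v hv huv =>
    ⟨fun h => ConnectedWithin.tail h hv huv,
      fun h => ConnectedWithin.tail h hu (by rw [norm1_sub_comm, huv])⟩
  -- Marks the edges between the component `P` and the complement of `O`.
  let a : Lattice d → Lattice d → ZMod 2 := fun x y =>
    if (x ∈ P ∧ y ∉ O) ∨ (y ∈ P ∧ x ∉ O) then 1 else 0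
  have aO : ∀ x ∈ O, ∀ y ∈ O, a x y = 0 := fun x hx y hy => by simp [a, hx, hy]
  have aC : ∀ x ∉ O, ∀ y ∉ O, a x y = 0 := fun x hx y hy => by
    have h1 : x ∉ P := fun h => hx (hHO (hPH h))
    have h2 : y ∉ P := fun h => hy (hHO (hPH h))
    simp [a, h1, h2]
  have ab : ∀ x y, (x ∈ O → x ∈ H) → (y ∈ O → y ∈ H) → norm1 (y - x) = 1 →
      a x y = (if x ∈ P then 1 else 0) + (if y ∈ P then 1 else 0) := by
    intro x y hx hy hxy
    by_cases h1 : x ∈ O <;> by_cases h2 : y ∈ O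
    · have := hP x (hx h1) y (hy h2) hxy
      by_cases h3 : y ∈ P
      · simp [aO x h1 y h2, this, h3, CharTwo.add_self_eq_zero]
      · simp [aO x h1 y h2, this, h3]
    · have h4 : y ∉ P := fun h => h2 (hHO (hPH h))
      simp [a, h2, h4]
    · have h4 : x ∉ P := fun h => h1 (hHO (hPH h))
      simp [a, h1, h4]
    · have h3 : x ∉ P := fun h => h1 (hHO (hPH h))
      have h4 : y ∉ P := fun h => h2 (hHO (hPH h))
      simp [a, h3, h4]
  obtain ⟨f, hf⟩ := exists_potential_of_symm a (fun x y => by simp only [a, or_comm]) (by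
    intro x i j hij
    obtain ⟨c1, c2, c3, c4⟩ := inCube_square x hij
    obtain ⟨n1, n2, n3, n4⟩ := norm1_square x i j
    -- If the cube with lowest corner `x` contains a boundary edge of `O`, all its points in `O` are
    -- near `W`, hence in `H`, and there `a` is the coboundary of the indicator of `P`. Otherwise
    -- `a` vanishes on the whole cube.
    by_cases hm : ∃ u v, InCube x u ∧ InCube x v ∧ u ∉ O ∧ v ∈ O ∧ norm1 (v - u) = 1
    · obtain ⟨u, v, hu, hv, huO, hvO, huv⟩ := hm
      have huW := hW u v huO hvO huv
      have key : ∀ w, InCube x w → w ∈ O → w ∈ H := fun w hw hwO => hH w hwO u huW (hu.near hw)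
      rw [ab _ _ (key _ c1) (key _ c2) n1, ab _ _ (key _ c2) (key _ c4) n2,
        ab _ _ (key _ c1) (key _ c3) n3, ab _ _ (key _ c3) (key _ c4) n4]
      exact zmod_two_add_cancel _ _ _ _
    · have key : ∀ u v, InCube x u → InCube x v → norm1 (v - u) = 1 → a u v = 0 := by
        intro u v hu hv huv
        by_cases h1 : u ∈ O <;> by_cases h2 : v ∈ O
        · exact aO u h1 v h2
        · exact absurd ⟨v, u, hv, hu, h2, h1, by rw [norm1_sub_comm, huv]⟩ hm
        · exact absurd ⟨u, v, hu, hv, h1, h2, huv⟩ hm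
        · exact aC u h1 v h2
      rw [key _ _ c1 c2 n1, key _ _ c2 c4 n2, key _ _ c1 c3 n3, key _ _ c3 c4 n4])
  have hfO : ∀ v ∈ O, f v = f (t 0) := fun v hv =>
    potential_eq_of_connected hf aO (hO _ h0 v hv)
  -- Leaving `O` from `P` raises `f` by one. Coming back at a point outside `P` would not change
  -- `f`, although `f` is constant on `O`; so every return is in `P`.
  have main : ∀ i ≤ N, (t i ∈ O ∧ t i ∈ P) ∨ (t i ∉ O ∧ f (t i) = f (t 0) + 1) := by
    intro i
    induction i with
    | zero => exact fun _ => Or.inl ⟨h0, .refl (htH 0 (Nat.zero_le _) h0)⟩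
    | succ i ih =>
      intro hi
      have hstep := ht i (by omega)
      have hfs := hf _ _ hstep
      by_cases h2 : t (i + 1) ∈ O
      · refine Or.inl ⟨h2, ?_⟩
        rcases ih (by omega) with ⟨h1, h3⟩ | ⟨h1, h3⟩
        · exact (hP _ (hPH h3) _ (htH _ hi h2) hstep).1 h3
        · by_contra h4
          have h5 : t i ∉ P := fun h => h1 (hHO (hPH h))
          have h6 : a (t i) (t (i + 1)) = 0 := by simp [a, h4, h5]
          rw [h6, h3, hfO _ h2, add_zero] at hfs
          simp at hfs
      · refine Or.inr ⟨h2, ?_⟩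
        rcases ih (by omega) with ⟨h1, h3⟩ | ⟨h1, h3⟩
        · have h6 : a (t i) (t (i + 1)) = 1 := by simp [a, h2, h3]
          rw [hfs, h6, hfO _ h1]
        · rw [hfs, aC _ h1 _ h2, h3, add_zero]
  rcases main N le_rfl with h | h
  · exact h.2
  · exact absurd hN h.1

open Classical in
/-- Let `O` be connected, with boundary edges to its complement ending in `W`. The endpoints of an
excursion outside `O` are joined by a chain of near points of `W`. -/
theorem reflTransGen_near_of_excursion (hO : IsLatticeConnected O)
    (hW : ∀ u v, u ∉ O → v ∈ O → norm1 (v - u) = 1 → u ∈ W)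
    {t : ℕ → Lattice d} {N : ℕ} (ht : ∀ i < N + 1, norm1 (t (i + 1) - t i) = 1)
    (htO : ∀ i, 1 ≤ i → i ≤ N → t i ∉ O) (hN1 : 1 ≤ N) (h0 : t 0 ∈ O) (hN : t (N + 1) ∈ O) :
    Relation.ReflTransGen (fun u v => v ∈ W ∧ Near u v) (t 1) (t N) := by
  let Y : Set (Lattice d) := {v | Relation.ReflTransGen (fun u v => v ∈ W ∧ Near u v) (t 1) v}
  -- Marks the boundary edges of `O` whose outside end lies in the near-cluster `Y` of `t 1`.
  let a : Lattice d → Lattice d → ZMod 2 := fun x y =>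
    if (x ∈ Y ∧ x ∉ O ∧ y ∈ O) ∨ (y ∈ Y ∧ y ∉ O ∧ x ∈ O) then 1 else 0
  have aO : ∀ x ∈ O, ∀ y ∈ O, a x y = 0 := fun x hx y hy => by simp [a, hx, hy]
  have aC : ∀ x ∉ O, ∀ y ∉ O, a x y = 0 := fun x hx y hy => by simp [a, hx, hy]
  obtain ⟨f, hf⟩ := exists_potential_of_symm a (fun x y => by simp only [a, or_comm]) (by
    intro x i j hij
    obtain ⟨c1, c2, c3, c4⟩ := inCube_square x hij
    obtain ⟨n1, n2, n3, n4⟩ := norm1_square x i j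
    let o : Lattice d → ZMod 2 := fun v => if v ∈ O then 1 else 0
    -- The outside ends of the boundary edges within one cube are near each other and lie in `W`, so
    -- either all these edges are marked or none. On the cube, `a` is therefore `0` or the
    -- coboundary of the indicator of `O`.
    obtain ⟨τ, hτ⟩ : ∃ τ : ZMod 2, ∀ u v, InCube x u → InCube x v → norm1 (v - u) = 1 →
        a u v = τ * (o u + o v) := by
      have hY : ∀ u v u' v', InCube x u → InCube x u' → u ∉ O → v ∈ O → norm1 (v - u) = 1 →
          u' ∉ O → v' ∈ O → norm1 (v' - u') = 1 → u ∈ Y → u' ∈ Y :=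
        fun u v u' v' hu hu' _ _ _ h1 h2 h3 h =>
          Relation.ReflTransGen.tail h ⟨hW u' v' h1 h2 h3, hu.near hu'⟩
      by_cases hm : ∃ u v, InCube x u ∧ u ∉ O ∧ v ∈ O ∧ norm1 (v - u) = 1 ∧ u ∈ Y
      · obtain ⟨u, v, hu, huO, hvO, huv, huY⟩ := hm
        refine ⟨1, fun u' v' hu' hv' huv' => ?_⟩
        by_cases h1 : u' ∈ O <;> by_cases h2 : v' ∈ O
        · simp [aO _ h1 _ h2, o, h1, h2, CharTwo.add_self_eq_zero]
        · have : v' ∈ Y := hY u v v' u' hu hv' huO hvO huv h2 h1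
            (by rw [norm1_sub_comm, huv']) huY
          simp [a, o, h1, h2, this]
        · have : u' ∈ Y := hY u v u' v' hu hu' huO hvO huv h1 h2 huv' huY
          simp [a, o, h1, h2, this]
        · simp [aC _ h1 _ h2, o, h1, h2]
      · refine ⟨0, fun u' v' hu' hv' huv' => ?_⟩
        simp only [a, zero_mul, ite_eq_right_iff, one_ne_zero, imp_false]
        rintro (⟨h1, h2, h3⟩ | ⟨h1, h2, h3⟩)
        · exact hm ⟨u', v', hu', h2, h3, huv', h1⟩
        · exact hm ⟨v', u', hv', h2, h3, by rw [norm1_sub_comm, huv'], h1⟩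
    rw [hτ _ _ c1 c2 n1, hτ _ _ c2 c4 n2, hτ _ _ c1 c3 n3, hτ _ _ c3 c4 n4, ← mul_add, ← mul_add,
      zmod_two_add_cancel _ (o (x + unitVec i)) _ (o (x + unitVec j))])
  have hfO : f (t (N + 1)) = f (t 0) := potential_eq_of_connected hf aO (hO _ h0 _ hN)
  have hf1 : f (t 1) = f (t 0) + 1 := by
    rw [hf _ _ (ht 0 (by omega))]
    have h1 : t 1 ∈ Y := Relation.ReflTransGen.refl
    simp [a, h0, htO 1 le_rfl hN1, h1]
  have hfi : ∀ i, i + 1 ≤ N → f (t (i + 1)) = f (t 0) + 1 := by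
    intro i
    induction i with
    | zero => exact fun _ => hf1
    | succ i ih =>
      intro hi
      rw [hf _ _ (ht (i + 1) (by omega)), aC _ (htO _ (by omega) (by omega)) _
        (htO _ (by omega) hi), add_zero, ih (by omega)]
  have hfN : f (t N) = f (t 0) + 1 := by
    obtain ⟨M, rfl⟩ := Nat.exists_eq_add_of_le' hN1
    exact hfi M le_rfl
  -- The potential is `f (t 0) + 1` throughout the excursion and `f (t 0)` after it, so the last
  -- edge is marked.
  have hlast := hf _ _ (ht N (by omega))
  by_contra hY
  have hY' : t N ∉ Y := hY
  have : a (t N) (t (N + 1)) = 0 := by simp [a, hY', htO N hN1 le_rfl]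
  rw [this, hfO, hfN, add_zero] at hlast
  simp at hlast

end Boundary

/-! ### The outer component. -/

/-- The points joined to the far corner `(N, …, N)` in the complement of `W`. -/
def outer {d : ℕ} (W : Set (Lattice d)) (N : ℤ) : Set (Lattice d) :=
  {v | ConnectedWithin Wᶜ (fun _ => N) v}

section Outer

variable {d : ℕ} {W : Set (Lattice d)} {N : ℤ}

theorem isLatticeConnected_outer : IsLatticeConnected (outer W N) :=
  isLatticeConnected_component _ _

theorem outer_subset_compl : outer W N ⊆ Wᶜ := fun _ h => ConnectedWithin.mem_right h

theorem mem_of_boundary_outer {u v : Lattice d} (hu : u ∉ outer W N) (hv : v ∈ outer W N)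
    (huv : norm1 (v - u) = 1) : u ∈ W := by
  by_contra h
  exact hu (ConnectedWithin.tail hv h (by rw [norm1_sub_comm, huv]))

/-- A geodesic keeps coordinate `i` fixed, so it never enters the box that contains `W`. -/
theorem connectedWithin_of_coord_eq (hW : ∀ w ∈ W, ∀ i, |w i| < N) {u v : Lattice d} {i : Fin d}
    (hi : N ≤ |u i|) (huv : u i = v i) : ConnectedWithin Wᶜ u v := by
  obtain ⟨s, h0, hn, hs, hc⟩ := exists_geodesic _ u v rfl
  refine ⟨_, s, h0, hn, fun k hk hkW => ?_, hs⟩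
  have := hW _ hkW i
  rw [hc k hk i huv] at this
  exact absurd this (not_lt.2 hi)

/-- Two coordinates are needed: coordinate `i` of `v` stays large while coordinate `j` is brought to
`N`, and then `j` keeps the path outside the box while the others move. -/
theorem mem_outer_of_le (hd : 2 ≤ d) (hW : ∀ w ∈ W, ∀ i, |w i| < N) {v : Lattice d} {i : Fin d}
    (hi : N ≤ |v i|) : v ∈ outer W N := by
  obtain ⟨j, hj⟩ : ∃ j : Fin d, j ≠ i := by
    have : Nontrivial (Fin d) := Fin.nontrivial_iff_two_le.2 hd
    exact exists_ne i
  have h1 : ConnectedWithin Wᶜ (fun _ => N) (Function.update v j N) :=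
    connectedWithin_of_coord_eq hW (i := j) (le_abs_self N) (by simp)
  have h2 : ConnectedWithin Wᶜ v (Function.update v j N) :=
    connectedWithin_of_coord_eq hW hi (by simp [hj.symm])
  exact h1.trans h2.symm

end Outer

/-! ### Walks with steps of size at most two, and their traces. -/

/-- The lattice points with coordinates in `[-2, 2]`. -/
noncomputable def stepSet (d : ℕ) : Finset (Lattice d) := Fintype.piFinset fun _ => Finset.Icc (-2) 2

theorem card_stepSet (d : ℕ) : (stepSet d).card = 5 ^ d := by
  simp [stepSet, Fintype.card_piFinset]

theorem Near.sub_mem_stepSet {d : ℕ} {u v : Lattice d} (h : Near u v) : v - u ∈ stepSet d := by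
  simp only [stepSet, Fintype.mem_piFinset, Finset.mem_Icc]
  exact fun k => abs_le.1 (h k)

theorem near_add_of_mem_stepSet {d : ℕ} (u : Lattice d) {e : Lattice d} (h : e ∈ stepSet d) :
    Near u (u + e) := by
  simp only [stepSet, Fintype.mem_piFinset, Finset.mem_Icc] at h
  intro k
  simpa using abs_le.2 (h k)

theorem near_of_norm1 {d : ℕ} {u v : Lattice d} (h : norm1 (v - u) = 1) : Near u v := by
  intro k
  have := natAbs_le_norm1 (v - u) k
  rw [h, Pi.sub_apply] at this
  exact abs_le.2 ⟨by omega, by omega⟩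

/-- The set of points visited by the walk from `y` with the given list of steps. -/
def trace {d : ℕ} : Lattice d → List (stepSet d) → Finset (Lattice d)
  | y, [] => {y}
  | y, e :: l => insert y (trace (y + e) l)

section Trace

variable {d : ℕ}

theorem mem_trace_self (y : Lattice d) (l : List (stepSet d)) : y ∈ trace y l := by
  cases l <;> simp [trace]

theorem card_trace_le (y : Lattice d) (l : List (stepSet d)) : (trace y l).card ≤ l.length + 1 := by
  induction l generalizing y with
  | nil => simp [trace]
  | cons e l ih => exact (Finset.card_insert_le _ _).trans (Nat.succ_le_succ (ih _))

theorem abs_sub_le_of_mem_trace {y v : Lattice d} {l : List (stepSet d)} (h : v ∈ trace y l)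
    (k : Fin d) : |v k - y k| ≤ 2 * l.length := by
  induction l generalizing y with
  | nil =>
    obtain rfl : v = y := by simpa [trace] using h
    simp
  | cons e l ih =>
    rcases Finset.mem_insert.1 h with rfl | h
    · simp only [sub_self, abs_zero]
      positivity
    · have h1 := ih h
      have h2 := near_add_of_mem_stepSet y e.2 k
      push_cast [List.length_cons]
      calc |v k - y k| ≤ |v k - (y + (e : Lattice d)) k| + |(y + (e : Lattice d)) k - y k| :=
            abs_sub_le _ _ _
        _ ≤ 2 * (l.length + 1) := by linarith

/-- Insert the round trip `v → w → v` at a visit to `v`. The two extra steps are the source of the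
term `2 * k` in `growthEvent`. -/
theorem exists_trace_eq_insert {y v w : Lattice d} {l : List (stepSet d)} (hv : v ∈ trace y l)
    (hvw : Near v w) : ∃ l' : List (stepSet d), l'.length = l.length + 2 ∧
      trace y l' = insert w (trace y l) := by
  have e1 : ∀ y : Lattice d, y + (w - y) = w := fun y => by abel
  have e2 : ∀ y : Lattice d, w + (y - w) = y := fun y => by abel
  induction l generalizing y with
  | nil =>
    obtain rfl : v = y := by simpa [trace] using hv
    refine ⟨[⟨w - v, hvw.sub_mem_stepSet⟩, ⟨v - w, hvw.symm.sub_mem_stepSet⟩], rfl, ?_⟩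
    ext z
    simp only [trace, e1, e2, Finset.mem_insert, Finset.mem_singleton]
    tauto
  | cons e l ih =>
    rcases Finset.mem_insert.1 hv with rfl | h
    · refine ⟨⟨w - v, hvw.sub_mem_stepSet⟩ :: ⟨v - w, hvw.symm.sub_mem_stepSet⟩ :: e :: l, rfl, ?_⟩
      ext z
      simp only [trace, e1, e2, Finset.mem_insert]
      tauto
    · obtain ⟨l', h1, h2⟩ := ih h
      refine ⟨e :: l', by simp [h1], ?_⟩
      simp only [trace, h2]
      exact Finset.insert_comm _ _ _

theorem exists_trace_of_walk (N : ℕ) : ∀ t : ℕ → Lattice d,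
    (∀ i < N, norm1 (t (i + 1) - t i) = 1) → ∃ l : List (stepSet d), l.length = N ∧
      ∀ v, v ∈ trace (t 0) l ↔ ∃ i ≤ N, v = t i := by
  induction N with
  | zero => exact fun t _ => ⟨[], rfl, fun v => by simp [trace]⟩
  | succ N ih =>
    intro t ht
    obtain ⟨l, h1, h2⟩ := ih (fun i => t (i + 1)) fun i hi => ht (i + 1) (by omega)
    refine ⟨⟨t 1 - t 0, (near_of_norm1 (ht 0 (by omega))).sub_mem_stepSet⟩ :: l, by simp [h1],
      fun v => ?_⟩
    have e : t 0 + (t 1 - t 0) = t (0 + 1) := by rw [zero_add]; abel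
    simp only [trace, e, Finset.mem_insert, h2]
    constructor
    · rintro (rfl | ⟨i, hi, rfl⟩)
      · exact ⟨0, Nat.zero_le _, rfl⟩
      · exact ⟨i + 1, by omega, rfl⟩
    · rintro ⟨_ | i, hi, rfl⟩
      · exact Or.inl rfl
      · exact Or.inr ⟨i, by omega, rfl⟩

end Trace

/-! ### Growth by closed sites. -/

/-- The event that `k` closed sites can be attached to the trace of the walk `l₀` from `y`. -/
def growthEvent {d : ℕ} (y : Lattice d) (l₀ : List (stepSet d)) (k : ℕ) : Set (Config d) :=
  {ω | ∃ l : List (stepSet d), l.length = l₀.length + 2 * k ∧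
    (trace y l \ trace y l₀).card = k ∧ ∀ v ∈ trace y l \ trace y l₀, ω v = false}

/-- If fewer than `k` closed sites can be attached to a walk, then the process of attaching near
closed sites terminates. -/
theorem exists_terminal_trace {d : ℕ} {ω : Config d} {y : Lattice d} {l₀ : List (stepSet d)} {k : ℕ}
    (h : ω ∉ growthEvent y l₀ k) : ∃ l : List (stepSet d), l.length ≤ l₀.length + 2 * k ∧
      trace y l₀ ⊆ trace y l ∧ (trace y l \ trace y l₀).card ≤ k ∧
      ∀ v ∈ trace y l, ∀ w, ω w = false → Near v w → w ∈ trace y l := by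
  -- The induction on `k` runs on a dichotomy: either `k` closed sites have been attached, or growth
  -- has already stopped.
  suffices H : (∃ l : List (stepSet d), l.length = l₀.length + 2 * k ∧ trace y l₀ ⊆ trace y l ∧
      (trace y l \ trace y l₀).card = k ∧ ∀ v ∈ trace y l \ trace y l₀, ω v = false) ∨
      ∃ l : List (stepSet d), l.length ≤ l₀.length + 2 * k ∧
      trace y l₀ ⊆ trace y l ∧ (trace y l \ trace y l₀).card ≤ k ∧
      ∀ v ∈ trace y l, ∀ w, ω w = false → Near v w → w ∈ trace y l by
    rcases H with ⟨l, h1, -, h2, h3⟩ | H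
    · exact absurd ⟨l, h1, h2, h3⟩ h
    · exact H
  clear h
  induction k with
  | zero => exact Or.inl ⟨l₀, by simp, subset_rfl, by simp, by simp⟩
  | succ k ih =>
    rcases ih with ⟨l, h1, h2, h3, h4⟩ | ⟨l, h1, h2, h3, h4⟩
    · by_cases hx : ∃ v ∈ trace y l, ∃ w, ω w = false ∧ Near v w ∧ w ∉ trace y l
      · obtain ⟨v, hv, w, hw, hvw, hwl⟩ := hx
        obtain ⟨l', h5, h6⟩ := exists_trace_eq_insert hv hvw
        have h7 : w ∉ trace y l₀ := fun h => hwl (h2 h)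
        have h8 : trace y l' \ trace y l₀ = insert w (trace y l \ trace y l₀) := by
          rw [h6, Finset.insert_sdiff_of_notMem _ h7]
        refine Or.inl ⟨l', by omega, ?_, ?_, ?_⟩
        · rw [h6]
          exact h2.trans (Finset.subset_insert _ _)
        · rw [h8, Finset.card_insert_of_notMem (by simp [hwl]), h3]
        · rw [h8]
          intro z hz
          rcases Finset.mem_insert.1 hz with rfl | hz
          · exact hw
          · exact h4 z hz
      · push Not at hx
        exact Or.inr ⟨l, by omega, h2, by omega, hx⟩
    · exact Or.inr ⟨l, by omega, h2, by omega, h4⟩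

/-! ### The deterministic construction. -/

section Deterministic

variable {d : ℕ} {ω : Config d}

/-- From any point, an axis ray leaves the complement of the outer component within distance
`4 m + 1`, provided that the clusters of `W` do not grow `m` times. -/
theorem exists_ray_exit (hd : 2 ≤ d) {W : Set (Lattice d)} {N m : ℕ}
    (hW : ∀ w ∈ W, ∀ i, |w i| < (N : ℤ)) (hWω : ∀ w ∈ W, ω w = false)
    (hm : ∀ w ∈ W, ω ∉ growthEvent w [] m) (i₀ : Fin d) (x : Lattice d) :
    ∃ a : ℕ, a ≤ 4 * m + 1 ∧ x + Pi.single i₀ (a : ℤ) ∈ outer W N ∧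
      ∀ k < a, x + Pi.single i₀ (k : ℤ) ∉ outer W N := by
  classical
  have hfar : ∀ k : ℤ, (N : ℤ) ≤ |x i₀ + k| → x + Pi.single i₀ k ∈ outer W N := fun k hk =>
    mem_outer_of_le hd hW (i := i₀) (by simpa using hk)
  have hA : ∃ a : ℕ, x + Pi.single i₀ (a : ℤ) ∈ outer W N :=
    ⟨N + (x i₀).natAbs, hfar _ (le_abs.2 (Or.inl (by push_cast; linarith [neg_abs_le (x i₀)])))⟩
  have hB : ∃ b : ℕ, x + Pi.single i₀ (-(b : ℤ)) ∈ outer W N :=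
    ⟨N + (x i₀).natAbs, hfar _ (le_abs.2 (Or.inr (by push_cast; linarith [le_abs_self (x i₀)])))⟩
  obtain ⟨a, ha, ha'⟩ : ∃ a : ℕ, x + Pi.single i₀ (a : ℤ) ∈ outer W N ∧
      ∀ k < a, x + Pi.single i₀ (k : ℤ) ∉ outer W N :=
    ⟨Nat.find hA, Nat.find_spec hA, fun k hk => Nat.find_min hA hk⟩
  obtain ⟨b, hb, hb'⟩ : ∃ b : ℕ, x + Pi.single i₀ (-(b : ℤ)) ∈ outer W N ∧
      ∀ k < b, x + Pi.single i₀ (-(k : ℤ)) ∉ outer W N :=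
    ⟨Nat.find hB, Nat.find_spec hB, fun k hk => Nat.find_min hB hk⟩
  refine ⟨a, ?_, ha, ha'⟩
  rcases Nat.eq_zero_or_pos a with rfl | ha0
  · omega
  have hb0 : 0 < b := by
    rcases Nat.eq_zero_or_pos b with rfl | h
    · exact absurd (by simpa using hb) (ha' 0 ha0)
    · exact h
  -- The axis segment through `x` from its first entry into `O` backwards to its first entry
  -- forwards; everything strictly between is outside `O`.
  let t : ℕ → Lattice d := fun i => x + Pi.single i₀ ((i : ℤ) - b)
  have ht : ∀ i, norm1 (t (i + 1) - t i) = 1 := by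
    intro i
    have : t (i + 1) - t i = Pi.single i₀ 1 := by
      simp only [t, add_sub_add_left_eq_sub, ← Pi.single_sub]
      congr 1
      push_cast
      ring
    rw [this, norm1_single]
    rfl
  have htO : ∀ i, 1 ≤ i → i ≤ a + b - 1 → t i ∉ outer W N := by
    intro i h1 h2
    rcases le_total b i with h | h
    · have := ha' (i - b) (by omega)
      rwa [Nat.cast_sub h] at this
    · have := hb' (b - i) (by omega)
      rwa [Nat.cast_sub h, neg_sub] at this
  have ht0 : t 0 ∈ outer W N := by simpa [t] using hb
  have htN : t (a + b - 1 + 1) ∈ outer W N := by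
    have e : ((a + b - 1 + 1 : ℕ) : ℤ) - b = a := by omega
    simpa only [t, e] using ha
  have hchain := reflTransGen_near_of_excursion isLatticeConnected_outer
    (fun u v hu hv huv => mem_of_boundary_outer hu hv huv) (fun i _ => ht i) htO (by omega) ht0 htN
  have ht1 : t 1 ∈ W := mem_of_boundary_outer (htO 1 le_rfl (by omega)) ht0
    (by rw [norm1_sub_comm]; exact ht 0)
  obtain ⟨l, hl, -, -, hcl⟩ := exists_terminal_trace (hm _ ht1)
  have hmem : ∀ z, Relation.ReflTransGen (fun u v => v ∈ W ∧ Near u v) (t 1) z →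
      z ∈ trace (t 1) l := by
    intro z hz
    induction hz with
    | refl => exact mem_trace_self _ _
    | tail _ h ih => exact hcl _ ih _ (hWω _ h.1) h.2
  -- The terminal list has at most `2 * m` steps, so `t 1` and its partner, which are `a + b - 2`
  -- apart, are at most `4 * m` apart; `b ≥ 1` then bounds `a`.
  have h := abs_sub_le_of_mem_trace (hmem _ hchain) i₀
  simp only [t, Pi.add_apply, Pi.single_eq_same] at h
  simp only [List.length_nil] at hl
  have := le_abs_self (x i₀ + (((a + b - 1 : ℕ) : ℤ) - b) - (x i₀ + (((1 : ℕ) : ℤ) - b)))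
  omega

/-- The deterministic construction of a connected open set of linear size near both endpoints of a
nearest-neighbour walk. -/
theorem exists_connected_open_set (hd : 2 ≤ d) {n m : ℕ} (hn : 1 ≤ n) {s : ℕ → Lattice d}
    (hs0 : s 0 = 0) (hs : ∀ i < n, norm1 (s (i + 1) - s i) = 1) {l₀ : List (stepSet d)}
    (hl₀ : l₀.length = n) (hl₀' : ∀ v, v ∈ trace 0 l₀ ↔ ∃ i ≤ n, v = s i)
    (hbad : ω ∉ growthEvent 0 l₀ n)
    (hm : ∀ y : Lattice d, (∀ i, |y i| ≤ 6 * n) → ω ∉ growthEvent y [] m) :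
    ∃ G : Set (Lattice d), (∀ y ∈ G, ω y = true) ∧ G.Finite ∧ G.ncard ≤ (2 + 3 * 5 ^ d) * n ∧
      IsLatticeConnected G ∧ (∃ v ∈ G, norm1 (v - 0) ≤ 4 * m + 1) ∧
      ∃ v ∈ G, norm1 (v - s n) ≤ 4 * m + 1 := by
  classical
  obtain ⟨l, hl, hsub, hcard, hcl⟩ := exists_terminal_trace hbad
  let W : Finset (Lattice d) := (trace 0 l).filter fun v => ω v = false
  have hWmem : ∀ {v}, v ∈ (W : Set (Lattice d)) ↔ v ∈ trace 0 l ∧ ω v = false := by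
    simp [W]
  -- The terminal list has at most `3 * n` steps, each changing a coordinate by at most `2`.
  have hWbox : ∀ w ∈ (W : Set (Lattice d)), ∀ i, |w i| ≤ 6 * n := by
    intro w hw i
    have := abs_sub_le_of_mem_trace (hWmem.1 hw).1 i
    rw [Pi.zero_apply, sub_zero] at this
    omega
  have hWcard : W.card ≤ 2 * n + 1 := by
    have h1 : W.card ≤ (trace 0 l).card := Finset.card_le_card (Finset.filter_subset _ _)
    have h2 := Finset.card_sdiff_add_card_eq_card hsub
    have h3 := card_trace_le 0 l₀
    omega
  let N : ℕ := 6 * n + 1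
  let O : Set (Lattice d) := outer W N
  have hOW : ∀ v ∈ O, v ∉ (W : Set (Lattice d)) := fun v hv => outer_subset_compl hv
  have hbd : ∀ u v, u ∉ O → v ∈ O → norm1 (v - u) = 1 → u ∈ (W : Set (Lattice d)) :=
    fun u v hu hv huv => mem_of_boundary_outer hu hv huv
  let H : Set (Lattice d) :=
    {v | v ∈ O ∧ (v ∈ trace 0 l₀ ∨ ∃ u ∈ (W : Set (Lattice d)), Near u v)}
  let i₀ : Fin d := ⟨0, by omega⟩
  have hexit := exists_ray_exit (ω := ω) hd (W := W) (N := N) (m := m)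
    (fun w hw i => by have := hWbox w hw i; simp only [N]; push_cast; omega)
    (fun w hw => (hWmem.1 hw).2) (fun w hw => hm w (hWbox w hw)) i₀
  obtain ⟨a, ha, haO, ha'⟩ := hexit (s 0)
  obtain ⟨b, hb, hbO, hb'⟩ := hexit (s n)
  have hray : ∀ j ≤ n, ∀ a : ℕ, s j + Pi.single i₀ (a : ℤ) ∈ O →
      (∀ k < a, s j + Pi.single i₀ (k : ℤ) ∉ O) → s j + Pi.single i₀ (a : ℤ) ∈ H := by
    intro j hj a ha ha'
    refine ⟨ha, ?_⟩
    rcases a with _ | a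
    · exact Or.inl ((hl₀' _).2 ⟨j, hj, by simp⟩)
    · have h1 : norm1 (s j + Pi.single i₀ ((a + 1 : ℕ) : ℤ) - (s j + Pi.single i₀ (a : ℤ))) = 1 := by
        rw [add_sub_add_left_eq_sub, ← Pi.single_sub, norm1_single]
        omega
      exact Or.inr ⟨_, hbd _ _ (ha' a (by omega)) ha h1, near_of_norm1 h1⟩
  -- Truncated subtraction glues three pieces: down the ray to `s 0`, along `s`, and up the ray from
  -- `s n`.
  let t : ℕ → Lattice d := fun i =>
    s (min (i - a) n) + Pi.single i₀ (((a - i) + (i - a - n) : ℕ) : ℤ)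
  have ht : ∀ i < a + n + b, norm1 (t (i + 1) - t i) = 1 := by
    intro i _
    rcases lt_or_ge i a with h | h
    · have e1 : i + 1 - a = 0 := by omega
      have e2 : i - a = 0 := by omega
      simp only [t, e1, e2]
      rw [add_sub_add_left_eq_sub, ← Pi.single_sub, norm1_single]
      omega
    · have e0 : a - i = 0 := by omega
      have e0' : a - (i + 1) = 0 := by omega
      rcases lt_or_ge (i - a) n with h' | h'
      · have e1 : min (i + 1 - a) n = (i - a) + 1 := by omega
        have e2 : min (i - a) n = i - a := by omega
        have e3 : i + 1 - a - n = 0 := by omega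
        have e4 : i - a - n = 0 := by omega
        simp only [t, e0, e0', e1, e2, e3, e4]
        rw [add_sub_add_right_eq_sub]
        exact hs _ h'
      · have e1 : min (i + 1 - a) n = n := by omega
        have e2 : min (i - a) n = n := by omega
        simp only [t, e1, e2]
        rw [add_sub_add_left_eq_sub, ← Pi.single_sub, norm1_single]
        omega
  have e0 : t 0 = s 0 + Pi.single i₀ (a : ℤ) := by simp [t]
  have eN : t (a + n + b) = s n + Pi.single i₀ (b : ℤ) := by
    have e1 : min (a + n + b - a) n = n := by omega
    have e2 : a - (a + n + b) + (a + n + b - a - n) = b := by omega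
    simp only [t, e1, e2]
  have htH : ∀ i ≤ a + n + b, t i ∈ O → t i ∈ H := by
    intro i hi hiO
    rcases Nat.eq_zero_or_pos i with rfl | hi0
    · rw [e0]
      exact hray 0 (Nat.zero_le _) a haO ha'
    rcases eq_or_lt_of_le hi with rfl | hi'
    · rw [eN]
      exact hray n le_rfl b hbO hb'
    rcases lt_or_ge i a with h | h
    · have e1 : min (i - a) n = 0 := by omega
      refine absurd hiO ?_
      simp only [t, e1]
      exact ha' _ (by omega)
    · rcases le_or_gt (i - a) n with h' | h'
      · have e1 : min (i - a) n = i - a := by omega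
        have e2 : a - i + (i - a - n) = 0 := by omega
        exact ⟨hiO, Or.inl ((hl₀' _).2 ⟨i - a, h', by simp only [t, e1, e2]; simp⟩)⟩
      · have e1 : min (i - a) n = n := by omega
        refine absurd hiO ?_
        simp only [t, e1]
        exact hb' _ (by omega)
  have hnear : ∀ w ∈ O, ∀ u ∈ (W : Set (Lattice d)), Near u w → w ∈ H :=
    fun w hw u hu huw => ⟨hw, Or.inr ⟨u, hu, huw⟩⟩
  have hconn : ConnectedWithin H (t 0) (t (a + n + b)) :=
    connectedWithin_detour isLatticeConnected_outer hbd (fun v hv => hv.1) hnear ht htH (by rw [e0]; exact haO)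
      (by rw [eN]; exact hbO)
  have hGH : {v | ConnectedWithin H (t 0) v} ⊆ H := fun v hv => ConnectedWithin.mem_right hv
  let F : Finset (Lattice d) := trace 0 l₀ ∪ W.biUnion fun u => (stepSet d).image fun e => u + e
  have hHF : H ⊆ F := by
    rintro v ⟨-, hv | ⟨u, hu, huv⟩⟩
    · exact Finset.mem_coe.2 (Finset.mem_union_left _ hv)
    · refine Finset.mem_coe.2 (Finset.mem_union_right _ (Finset.mem_biUnion.2 ⟨u, hu, ?_⟩))
      exact Finset.mem_image.2 ⟨v - u, huv.sub_mem_stepSet, by abel⟩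
  have hFcard : F.card ≤ (2 + 3 * 5 ^ d) * n := by
    have h1 : (W.biUnion fun u => (stepSet d).image fun e => u + e).card ≤ W.card * 5 ^ d :=
      Finset.card_biUnion_le_card_mul _ _ _ fun u _ =>
        Finset.card_image_le.trans (card_stepSet d).le
    calc F.card ≤ (trace 0 l₀).card + W.card * 5 ^ d :=
          (Finset.card_union_le _ _).trans (Nat.add_le_add_left h1 _)
      _ ≤ 2 * n + 3 * n * 5 ^ d := by
          refine Nat.add_le_add ?_ (Nat.mul_le_mul_right _ (by omega))
          have := card_trace_le 0 l₀
          omega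
      _ = (2 + 3 * 5 ^ d) * n := by ring
  refine ⟨{v | ConnectedWithin H (t 0) v}, fun y hy => ?_, F.finite_toSet.subset (hGH.trans hHF),
    ?_, isLatticeConnected_component _ _, ⟨t 0, .refl (htH 0 (Nat.zero_le _) (by rw [e0]; exact haO)),
      ?_⟩, ⟨t (a + n + b), hconn, ?_⟩⟩
  -- A closed point of `H` would be in the terminal trace, hence in `W`, which `O` avoids.
  · obtain ⟨hyO, hy⟩ := hGH hy
    by_contra hω
    rw [Bool.not_eq_true] at hω
    refine hOW y hyO (hWmem.2 ⟨?_, hω⟩)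
    rcases hy with hy | ⟨u, hu, huy⟩
    · exact hsub hy
    · exact hcl u (hWmem.1 hu).1 y hω huy
  · refine (Set.ncard_le_ncard (hGH.trans hHF) F.finite_toSet).trans ?_
    rwa [Set.ncard_coe_finset]
  · rw [e0, hs0, zero_add, sub_zero, norm1_single]
    simpa using ha
  · rw [eN, add_sub_cancel_left, norm1_single]
    simpa using hb

end Deterministic

/-! ### Probability estimates. -/

open MeasureTheory
open scoped ENNReal

instance isProbabilityMeasure_bernoulliLaw (d : ℕ) (p : unitInterval) :
    IsProbabilityMeasure (bernoulliLaw d p) := by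
  unfold bernoulliLaw
  infer_instance

theorem bernoulliLaw_real_closed {d : ℕ} (p : unitInterval) (S : Finset (Lattice d)) :
    (bernoulliLaw d p).real {ω | ∀ v ∈ S, ω v = false} = (1 - (p : ℝ)) ^ S.card := by
  have h : {ω : Config d | ∀ v ∈ S, ω v = false} =
      Set.pi (S : Set (Lattice d)) fun _ => ({false} : Set Bool) := by
    ext ω
    simp [Set.mem_pi]
  have h1 : (ProbabilityTheory.bernoulliMeasure true false p).real {false} = 1 - (p : ℝ) := by
    rw [ProbabilityTheory.bernoulliMeasure_real_apply_of_notMem_of_mem] <;> simp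
  rw [h, bernoulliLaw, measureReal_def, Measure.infinitePi_pi _ (fun _ _ => by simp),
    ENNReal.toReal_prod, ← h1, Finset.prod_const, measureReal_def]

/-- A union bound over step lists: each fixed list determines the `k` sites that have to be closed.
-/
theorem growthEvent_real_le {d : ℕ} {p : unitInterval} {α : ℝ} (hp : 1 - α ≤ (p : ℝ))
    (y : Lattice d) (l₀ : List (stepSet d)) (k : ℕ) :
    (bernoulliLaw d p).real (growthEvent y l₀ k) ≤ ((5 : ℝ) ^ d) ^ (l₀.length + 2 * k) * α ^ k := by
  let E : List.Vector (stepSet d) (l₀.length + 2 * k) → Set (Config d) := fun v =>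
    {ω | (trace y v.toList \ trace y l₀).card = k ∧ ∀ z ∈ trace y v.toList \ trace y l₀, ω z = false}
  have hα : 0 ≤ α := by linarith [p.2.2]
  have hE : ∀ v, (bernoulliLaw d p).real (E v) ≤ α ^ k := by
    intro v
    by_cases hk : (trace y v.toList \ trace y l₀).card = k
    · calc (bernoulliLaw d p).real (E v)
          ≤ (bernoulliLaw d p).real {ω | ∀ z ∈ trace y v.toList \ trace y l₀, ω z = false} :=
            measureReal_mono fun ω hω => hω.2
        _ = (1 - (p : ℝ)) ^ k := by rw [bernoulliLaw_real_closed, hk]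
        _ ≤ α ^ k := pow_le_pow_left₀ (by linarith [p.2.2]) (by linarith) k
    · have : E v = ∅ := by
        ext ω
        simp [E, hk]
      rw [this, measureReal_empty]
      positivity
  have hsub : growthEvent y l₀ k ⊆ ⋃ v, E v := by
    rintro ω ⟨l, h1, h2, h3⟩
    exact Set.mem_iUnion.2 ⟨⟨l, h1⟩, h2, h3⟩
  calc (bernoulliLaw d p).real (growthEvent y l₀ k)
      ≤ (bernoulliLaw d p).real (⋃ v, E v) := measureReal_mono hsub
    _ ≤ ∑ v, (bernoulliLaw d p).real (E v) := measureReal_iUnion_fintype_le _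
    _ ≤ ∑ _v : List.Vector (stepSet d) (l₀.length + 2 * k), α ^ k :=
        Finset.sum_le_sum fun v _ => hE v
    _ = _ := by
        rw [Finset.sum_const, Finset.card_univ, card_vector, Fintype.card_coe, card_stepSet]
        simp

theorem distToSet_le_of_mem {d : ℕ} {z v : Lattice d} {G : Set (Lattice d)} (hv : v ∈ G) {m : ℕ}
    (h : norm1 (v - z) ≤ m) {r : ℝ} (hr : (m : ℝ) ≤ r) : distToSet z G ≤ ENNReal.ofReal r := by
  refine (iInf₂_le v hv).trans ?_
  rw [← ENNReal.ofReal_natCast]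
  exact ENNReal.ofReal_le_ofReal ((Nat.cast_le.2 h).trans hr)

/-- The closed-site density below which the construction works. -/
noncomputable def criticalDensity (d : ℕ) : ℝ := (((5 : ℝ) ^ d) ^ 3)⁻¹ * Real.exp (-1)

theorem criticalDensity_pos (d : ℕ) : 0 < criticalDensity d := by
  unfold criticalDensity
  positivity

theorem criticalDensity_lt_one (d : ℕ) : criticalDensity d < 1 := by
  have h1 : (((5 : ℝ) ^ d) ^ 3)⁻¹ ≤ 1 :=
    inv_le_one_of_one_le₀ (one_le_pow₀ (one_le_pow₀ (by norm_num)))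
  have h2 : Real.exp (-1) < 1 := by
    rw [← Real.exp_zero, Real.exp_lt_exp]
    norm_num
  exact (mul_le_of_le_one_left (Real.exp_pos _).le h1).trans_lt h2

/-- Quantitative bound on the probability that there is no global structure. -/
theorem compl_globalEvent_real_le {d : ℕ} (hd : 2 ≤ d) {δ : ℝ} {p : unitInterval}
    (hp : 1 - criticalDensity d ≤ (p : ℝ)) {x : Lattice d} (hx : x ≠ 0) {m : ℕ}
    (hm : (4 * m + 1 : ℝ) ≤ Real.log (norm1 x : ℝ) ^ (1 + δ)) :
    (bernoulliLaw d p).real (globalEvent x (2 + 3 * 5 ^ d) δ)ᶜ ≤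
      Real.exp (-(norm1 x : ℝ)) + (12 * norm1 x + 1 : ℝ) ^ d * Real.exp (-(m : ℝ)) := by
  obtain ⟨n, hn⟩ : ∃ n, n = norm1 x := ⟨_, rfl⟩
  rw [← hn] at hm ⊢
  have hn1 : 1 ≤ n := by
    rw [hn, Nat.one_le_iff_ne_zero]
    exact fun h => hx (norm1_eq_zero.1 h)
  obtain ⟨s, hs0, hsn, hs, -⟩ := exists_geodesic n 0 x (by rw [sub_zero, hn])
  obtain ⟨l₀, hl₀, hl₀'⟩ := exists_trace_of_walk n s hs
  rw [hs0] at hl₀'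
  let B : Finset (Lattice d) := Fintype.piFinset fun _ => Finset.Icc (-(6 * n : ℤ)) (6 * n)
  have hB : B.card = (12 * n + 1) ^ d := by
    have e : ((6 * n : ℤ) + 1 - -(6 * n : ℤ)).toNat = 12 * n + 1 := by omega
    simp only [B, Fintype.card_piFinset, Int.card_Icc, e, Finset.prod_const, Finset.card_univ,
      Fintype.card_fin]
  have hsub : (globalEvent x (2 + 3 * 5 ^ d) δ)ᶜ ⊆
      growthEvent 0 l₀ n ∪ ⋃ y ∈ B, growthEvent y [] m := by
    intro ω hω
    by_contra hc
    simp only [Set.mem_union, Set.mem_iUnion, not_or, not_exists] at hc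
    obtain ⟨G, hG1, hG2, hG3, hG4, ⟨v, hv, hv'⟩, ⟨w, hw, hw'⟩⟩ :=
      exists_connected_open_set hd hn1 hs0 hs hl₀ hl₀' hc.1
        (fun y hy => hc.2 y (Fintype.mem_piFinset.2 fun i => Finset.mem_Icc.2 (abs_le.1 (hy i))))
    rw [hsn] at hw'
    refine hω ⟨G, hG1, hG2, ?_, hG4, ?_, ?_⟩
    · rw [← hn]
      exact_mod_cast hG3
    · rw [← hn]
      exact distToSet_le_of_mem hv hv' (by exact_mod_cast hm)
    · rw [← hn]
      exact distToSet_le_of_mem hw hw' (by exact_mod_cast hm)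
  have h5 : (1 : ℝ) ≤ 5 ^ d := one_le_pow₀ (by norm_num)
  have hA : (bernoulliLaw d p).real (growthEvent 0 l₀ n) ≤ Real.exp (-(n : ℝ)) := by
    refine (growthEvent_real_le hp 0 l₀ n).trans (le_of_eq ?_)
    -- Three steps per attached site: `criticalDensity` is chosen so that `(5 ^ d) ^ 3 * α = exp
    -- (-1)`.
    have e : l₀.length + 2 * n = 3 * n := by omega
    rw [e, pow_mul, ← mul_pow, criticalDensity, ← mul_assoc, mul_inv_cancel₀ (by positivity),
      one_mul, ← Real.exp_nat_mul]
    congr 1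
    ring
  have hY : ∀ y ∈ B, (bernoulliLaw d p).real (growthEvent y [] m) ≤ Real.exp (-(m : ℝ)) := by
    intro y _
    refine (growthEvent_real_le hp y [] m).trans ?_
    have e1 : Real.exp (-(m : ℝ)) = Real.exp (-1) ^ m := by
      rw [← Real.exp_nat_mul]
      congr 1
      ring
    rw [List.length_nil, zero_add, pow_mul, ← mul_pow, e1]
    refine pow_le_pow_left₀ (mul_nonneg (by positivity) (criticalDensity_pos d).le) ?_ m
    rw [criticalDensity, ← mul_assoc]
    refine mul_le_of_le_one_left (Real.exp_pos _).le ?_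
    rw [← div_eq_mul_inv, div_le_one (by positivity)]
    exact pow_le_pow_right₀ h5 (by norm_num)
  calc (bernoulliLaw d p).real (globalEvent x (2 + 3 * 5 ^ d) δ)ᶜ
      ≤ (bernoulliLaw d p).real (growthEvent 0 l₀ n ∪ ⋃ y ∈ B, growthEvent y [] m) :=
        measureReal_mono hsub
    _ ≤ (bernoulliLaw d p).real (growthEvent 0 l₀ n) +
        (bernoulliLaw d p).real (⋃ y ∈ B, growthEvent y [] m) := measureReal_union_le _ _
    _ ≤ Real.exp (-(n : ℝ)) + ∑ y ∈ B, (bernoulliLaw d p).real (growthEvent y [] m) :=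
        add_le_add hA (measureReal_biUnion_finset_le _ _)
    _ ≤ Real.exp (-(n : ℝ)) + B.card • Real.exp (-(m : ℝ)) := by
        gcongr
        exact Finset.sum_le_card_nsmul _ _ _ hY
    _ = _ := by
        rw [hB, nsmul_eq_mul]
        push_cast
        rfl

/-! ### Choice of scales and conclusion. -/

/-- The scale `(log n) ^ (1 + δ)` eventually lies between multiples of `log n` and `n`. -/
theorem exists_scale_threshold (d : ℕ) {δ : ℝ} (hδ : 0 < δ) : ∃ n₀ : ℕ, 1 ≤ n₀ ∧ ∀ n : ℕ, n₀ ≤ n →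
    1 ≤ Real.log n ^ (1 + δ) ∧ Real.log n ^ (1 + δ) ≤ n ∧
      d * Real.log n ≤ Real.log n ^ (1 + δ) / 8 := by
  have hlog : Filter.Tendsto (fun n : ℕ => Real.log n) Filter.atTop Filter.atTop :=
    Real.tendsto_log_atTop.comp tendsto_natCast_atTop_atTop
  have h1 := hlog.eventually (Filter.eventually_ge_atTop 1)
  have h2 := hlog.eventually ((tendsto_rpow_atTop hδ).eventually
    (Filter.eventually_ge_atTop (8 * d : ℝ)))
  have h3 := tendsto_natCast_atTop_atTop (R := ℝ) |>.eventually
    ((isLittleO_log_rpow_rpow_atTop (1 + δ) one_pos).bound one_pos)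
  obtain ⟨n₀, hn₀⟩ := Filter.eventually_atTop.1 (h1.and (h2.and h3))
  refine ⟨n₀ + 1, by omega, fun n hn => ?_⟩
  obtain ⟨h1, h2, h3⟩ := hn₀ n (by omega)
  have h0 : 0 < Real.log n := one_pos.trans_le h1
  refine ⟨Real.one_le_rpow h1 (by linarith), ?_, ?_⟩
  · rw [one_mul, Real.rpow_one, Real.norm_of_nonneg (by positivity),
      Real.norm_of_nonneg (by positivity)] at h3
    exact h3
  · rw [Real.rpow_add h0, Real.rpow_one]
    nlinarith

end SitePercolation

theorem proposition3p6 :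
    ∀ d : ℕ, 2 ≤ d → ∃ α : ℝ, 0 < α ∧ α < 1 ∧
      ∀ δ : ℝ, 0 < δ → ∃ c C C₀ : ℝ, 0 < c ∧ 0 < C ∧ 0 < C₀ ∧
        ∀ p : unitInterval, 1 - α ≤ (p : ℝ) →
          ∀ x : SitePercolation.Lattice d, x ≠ 0 →
            (SitePercolation.bernoulliLaw d p).real (SitePercolation.globalEvent x C₀ δ) >
              1 - C * Real.exp (-c * Real.log (SitePercolation.norm1 x : ℝ) ^ (1 + δ)) := by
  intro d hd
  refine ⟨SitePercolation.criticalDensity d, SitePercolation.criticalDensity_pos d,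
    SitePercolation.criticalDensity_lt_one d, fun δ hδ => ?_⟩
  obtain ⟨n₀, hn₀, hscale⟩ := SitePercolation.exists_scale_threshold d hδ
  obtain ⟨R₀, hR₀⟩ : ∃ R₀ : ℝ, R₀ = Real.log n₀ ^ (1 + δ) := ⟨_, rfl⟩
  -- Since `m > (R - 1) / 4 - 1`, the factor `exp (-m)` is at most `exp (2 - R / 4)`, and absorbing
  -- `n ^ d ≤ exp (R / 8)` leaves the rate `1 / 8`. The last term of `C` makes the claim trivial for
  -- `n < n₀`; the `2` covers `exp (-n)` with room for the strict inequality.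
  refine ⟨1 / 8, 2 + 13 ^ d * Real.exp 2 + 2 * Real.exp (R₀ / 8), 2 + 3 * 5 ^ d, by norm_num,
    by positivity, by positivity, fun p hp x hx => ?_⟩
  obtain ⟨n, hn⟩ : ∃ n, n = SitePercolation.norm1 x := ⟨_, rfl⟩
  have hn1 : 1 ≤ n := by
    rw [hn, Nat.one_le_iff_ne_zero]
    exact fun h => hx (SitePercolation.norm1_eq_zero.1 h)
  have hn1' : (1 : ℝ) ≤ n := by exact_mod_cast hn1
  obtain ⟨R, hR⟩ : ∃ R : ℝ, R = Real.log n ^ (1 + δ) := ⟨_, rfl⟩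
  rw [← hn, ← hR]
  have hpos : 0 < Real.exp (-(1 / 8) * R) := Real.exp_pos _
  rcases lt_or_ge n n₀ with hlt | hge
  · have hRR : R ≤ R₀ := by
      rw [hR, hR₀]
      exact Real.rpow_le_rpow (Real.log_nonneg hn1')
        (Real.log_le_log (by positivity) (by exact_mod_cast hlt.le)) (by linarith)
    have h1 : 1 ≤ Real.exp (R₀ / 8) * Real.exp (-(1 / 8) * R) := by
      rw [← Real.exp_add]
      exact Real.one_le_exp (by linarith)
    have h2 : 0 < (2 + 13 ^ d * Real.exp 2) * Real.exp (-(1 / 8) * R) := by positivity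
    have h3 : 0 ≤ (SitePercolation.bernoulliLaw d p).real
      (SitePercolation.globalEvent x (2 + 3 * 5 ^ d) δ) :=
      MeasureTheory.measureReal_nonneg
    nlinarith
  · obtain ⟨hs1, hs2, hs3⟩ := hscale n hge
    rw [← hR] at hs1 hs2 hs3
    -- The largest `m` with `4 * m + 1 ≤ R`.
    obtain ⟨m, hm⟩ : ∃ m : ℕ, m = ⌊(R - 1) / 4⌋₊ := ⟨_, rfl⟩
    have hm1 : (m : ℝ) ≤ (R - 1) / 4 := by
      rw [hm]
      exact Nat.floor_le (by linarith)
    have hm2 : (R - 1) / 4 < m + 1 := by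
      rw [hm]
      exact Nat.lt_floor_add_one _
    have hbound := SitePercolation.compl_globalEvent_real_le hd (δ := δ) hp hx (m := m)
      (by rw [← hn, ← hR]; linarith)
    rw [← hn, MeasureTheory.probReal_compl_eq_one_sub
      (SitePercolation.measurableSet_globalEvent x _ δ)] at hbound
    have h1 : Real.exp (-(n : ℝ)) ≤ Real.exp (-(1 / 8) * R) := Real.exp_le_exp.2 (by linarith)
    have h2 : (12 * n + 1 : ℝ) ^ d * Real.exp (-(m : ℝ)) ≤
        13 ^ d * Real.exp 2 * Real.exp (-(1 / 8) * R) := by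
      have e1 : (n : ℝ) ^ d = Real.exp (d * Real.log n) := by
        rw [Real.exp_nat_mul, Real.exp_log (by linarith)]
      calc (12 * n + 1 : ℝ) ^ d * Real.exp (-(m : ℝ))
          ≤ (13 * n : ℝ) ^ d * Real.exp (-(m : ℝ)) := by
            gcongr
            linarith
        _ = 13 ^ d * Real.exp (d * Real.log n + -(m : ℝ)) := by
            rw [mul_pow, e1, Real.exp_add, mul_assoc]
        _ ≤ 13 ^ d * Real.exp (2 + -(1 / 8) * R) :=
            mul_le_mul_of_nonneg_left (Real.exp_le_exp.2 (by linarith)) (by positivity)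
        _ = _ := by rw [Real.exp_add, mul_assoc]
    have h3 : 0 < Real.exp (R₀ / 8) * Real.exp (-(1 / 8) * R) := by positivity
    nlinarith
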